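/- Let $p<q<r$ be primes, let $a,b,c\ge 1$ be integers, and let $G$ be a group of order $|G|=p^aq^br^c$. Suppose that $G$ is not nilpotent and that $G$ is not isomorphic to a direct product $H\times K$ of two nontrivial groups $H,K$ of coprime orders. Let $i$ and $j$ be the least non-negative integers with $p^i\ge r+1$ and $q^j\ge r+1$. Then the number $|\operatorname{Sub} G|$ of subgroups of $G$ satisfies $$|\operatorname{Sub} G|\;\ge\; a+b+c+(a-1)\min(b+1,p)+(b-1)\min(c+1,q)+(c-1)\min(a+1,r)+M,$$ where $$M=\min\bigl\{\,p+q+r+2,\;\; q+2+\min(p^i+1,\,q^j,\,2r+1),\;\; \min(r+1,2q+2)+\min(r+1,2q)\,\bigr\}.$$ -/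

import Mathlib

universe u

/-- `G` is isomorphic to a direct product `H × K` of two nontrivial groups of coprime orders. -/
def IsCoprimeDirectProduct (G : Type u) [Group G] : Prop :=
  ∃ (H K : Type u) (_ : Group H) (_ : Group K),
    Nontrivial H ∧ Nontrivial K ∧ Nat.Coprime (Nat.card H) (Nat.card K) ∧
      Nonempty (G ≃* H × K)

/-! Subgroups are counted by order, over exponent triples chosen so that no order is used twice. By
Frobenius's congruence (`Subgroup.numOfCard_prime_pow_modEq_one`), subgroups of a prime power order
`s ^ k` number 1 or at least `s + 1`. A unique one is normal, so its products with subgroups of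
order prime to `s` realise further orders; this handles the intermediate exponents. For a full Sylow
order `s ^ e`, a normal Sylow subgroup has a Schur–Zassenhaus complement. Indecomposability keeps
that complement from being normal, so it has at least `s` conjugates, and the orders `s ^ e` and
`|G| / s ^ e` together contribute at least `s + 1`. The trivial subgroup and the whole group add 2.
-/

open MulAction
open scoped Pointwise

/-- The number of subgroups of order `n` of the group `G`. -/
noncomputable def Subgroup.numOfCard (G : Type*) [Group G] (n : ℕ) : ℕ :=
  Nat.card {H : Subgroup G // Nat.card H = n}

/-! ### Frobenius's congruence by Wielandt's method -/

section Wielandt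

variable {G : Type*} [Group G]

/-- The stabilizer acts freely on `A` by left multiplication, so `A` is a union of its right cosets.
-/
theorem Set.card_stabilizer_dvd_ncard (A : Set G) :
    Nat.card (stabilizer G A) ∣ A.ncard := by
  have h : ∀ a ∈ A, ∀ g ∈ stabilizer G A, g * a ∈ A := fun a ha g hg =>
    ((mem_stabilizer_set.1 hg) a).2 ha
  let _ : MulAction (stabilizer G A) A :=
    { smul := fun g a => ⟨g.1 * a.1, h a.1 a.2 g.1 g.2⟩
      one_smul := fun a => Subtype.ext (one_mul _)
      mul_smul := fun g h a => Subtype.ext (mul_assoc _ _ _) }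
  have hfree : ∀ a : A, stabilizer (stabilizer G A) a = ⊥ := by
    intro a
    rw [eq_bot_iff]
    intro g hg
    have : g.1 * a.1 = a.1 := congrArg Subtype.val (mem_stabilizer_iff.1 hg)
    exact Subtype.ext (by simpa using this)
  have e : A ≃ Quotient (orbitRel (stabilizer G A) A) × stabilizer G A :=
    selfEquivOrbitsQuotientProd hfree
  rw [← Nat.card_coe_set_eq, Nat.card_congr e, Nat.card_prod]
  exact dvd_mul_left _ _

/-- Equality forces `A` to be a single right coset `S * a` of its stabilizer `S`; translating by
`a⁻¹` gives the conjugate `a⁻¹ * S * a`. -/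
theorem Set.exists_smul_eq_coe_subgroup [Finite G] (A : Set G)
    (hA : A.Nonempty) (h : Nat.card (stabilizer G A) = A.ncard) :
    ∃ (g : G) (H : Subgroup G), g • A = H := by
  obtain ⟨a, ha⟩ := hA
  have hsub : (MulOpposite.op a) • (stabilizer G A : Set G) = A := by
    apply Set.eq_of_subset_of_ncard_le (MulAction.op_smul_set_stabilizer_subset ha) _ A.toFinite
    rw [Set.ncard_smul_set, ← h, ← Nat.card_coe_set_eq]
    rfl
  refine ⟨a⁻¹, (stabilizer G A).map (MulAut.conj a⁻¹).toMonoidHom, ?_⟩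
  nth_rw 1 [← hsub]
  ext x
  simp [Set.mem_smul_set, mul_assoc]

/-- Wielandt's count: the sets of `s ^ k` elements, grouped by orbits under left translation. -/
theorem Subgroup.choose_modEq_mul_numOfCard [Finite G] {s k m : ℕ} (hs : s.Prime)
    (hG : Nat.card G = m * s ^ k) :
    (Nat.card G).choose (s ^ k) ≡ m * numOfCard G (s ^ k) [MOD m * s] := by
  classical
  set n := s ^ k with hn
  have hn0 : 0 < n := pow_pos hs.pos k
  let X := Set.powersetCard G n
  let Ω := orbitRel.Quotient G X
  have : Fintype Ω := Fintype.ofFinite _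
  have hcard : (Nat.card G).choose n = ∑ ω : Ω, Nat.card (orbit G (ω.out : X)) := by
    rw [← Set.powersetCard.card, Nat.card_congr (selfEquivSigmaOrbits G X), Nat.card_sigma]
  have horb : ∀ x : X, Nat.card (orbit G x) ≡
      (if Nat.card (stabilizer G x) = n then m else 0) [MOD m * s] := by
    intro x
    have hos : Nat.card (orbit G x) * Nat.card (stabilizer G x) = m * n := by
      rw [← hG, ← Nat.card_prod, Nat.card_congr (orbitProdStabilizerEquivGroup G x)]
    have hdvd : Nat.card (stabilizer G x) ∣ n := by
      have := Set.card_stabilizer_dvd_ncard (x : Set G)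
      rwa [Set.powersetCard.ncard_eq, ← Set.powersetCard.stabilizer_coe] at this
    split_ifs with h
    · rw [h] at hos
      rw [Nat.eq_of_mul_eq_mul_right hn0 hos]
    · rw [Nat.modEq_zero_iff_dvd]
      obtain ⟨j, hj, hj'⟩ := (Nat.dvd_prime_pow hs).1 hdvd
      have hjk : j < k := lt_of_le_of_ne hj (by rintro rfl; exact h hj')
      obtain ⟨d, rfl⟩ := Nat.exists_eq_add_of_lt hjk
      rw [hj'] at hos
      -- Here `k = j + d + 1`, so the orbit has `m * s ^ (d + 1)` elements.
      refine ⟨s ^ d, Nat.eq_of_mul_eq_mul_right (pow_pos hs.pos j) (hos.trans ?_)⟩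
      simp only [hn]
      ring
  have hsmul : ∀ (g : G) (x : X), ((g • x : X) : Set G) = g • (x : Set G) := fun g x => by
    rw [← Set.powersetCard.coe_coe, Set.powersetCard.coe_smul, Finset.coe_smul_finset]
    rfl
  -- Each orbit whose stabilizers have order `n` contains exactly one subgroup.
  have hbij : numOfCard G n = Nat.card {ω : Ω // Nat.card (stabilizer G (ω.out : X)) = n} := by
    have hstab : ∀ x : X, Nat.card (stabilizer G (Quotient.out (s := orbitRel G X) ⟦x⟧)) =
        Nat.card (stabilizer G x) := by
      intro x
      have hx : orbitRel G X (Quotient.out (s := orbitRel G X) ⟦x⟧) x := Quotient.mk_out x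
      exact Nat.card_congr (stabilizerEquivStabilizerOfOrbitRel hx).toEquiv
    let F : {H : Subgroup G // Nat.card H = n} → X := fun H =>
      ⟨(H.1 : Set G).toFinite.toFinset, by
        rw [Set.powersetCard.mem_iff, ← Set.ncard_eq_toFinset_card, ← Nat.card_coe_set_eq]
        exact H.2⟩
    have hF : ∀ H, (F H : Set G) = H.1 := fun H => Set.Finite.coe_toFinset _
    refine Nat.card_eq_of_bijective (fun H => ⟨⟦F H⟧, ?_⟩) ⟨?_, ?_⟩
    · rw [hstab, Set.powersetCard.stabilizer_coe, hF, stabilizer_subgroup, H.2]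
    · intro H K hHK
      have h : orbitRel G X (F H) (F K) := Quotient.exact (congrArg Subtype.val hHK)
      obtain ⟨g, hg⟩ := h
      have hg' : g • (K.1 : Set G) = H.1 := by
        rw [← hF, ← hF, ← hsmul]
        exact congrArg (fun x : X => (x : Set G)) hg
      -- A translate of `K` that is a subgroup contains 1, hence equals `K`.
      have h1 : g⁻¹ ∈ K.1 := by
        have : (1 : G) ∈ g • (K.1 : Set G) := by rw [hg']; exact H.1.one_mem
        simpa [Set.mem_smul_set_iff_inv_smul_mem] using this
      apply Subtype.ext
      apply SetLike.coe_injective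
      rw [← hg']
      ext x
      simp [Set.mem_smul_set_iff_inv_smul_mem, K.1.mul_mem_cancel_left h1]
    · rintro ⟨ω, hω⟩
      obtain ⟨g, H, hgH⟩ := Set.exists_smul_eq_coe_subgroup (ω.out : Set G)
        (Set.powersetCard.coe_nonempty_iff.2 hn0)
        (by rw [← Set.powersetCard.stabilizer_coe, hω, Set.powersetCard.ncard_eq])
      have hH : Nat.card H = n := by
        have h := Set.powersetCard.ncard_eq (g • ω.out : X)
        rwa [hsmul, hgH, ← Nat.card_coe_set_eq] at h
      refine ⟨⟨H, hH⟩, Subtype.ext ?_⟩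
      refine Eq.trans (Quotient.sound (s := orbitRel G X) ⟨g, ?_⟩) (Quotient.out_eq ω)
      apply SetLike.coe_injective
      rw [hF, ← hgH]
      exact hsmul g ω.out
  rw [hcard, hbij]
  have h2 : ∑ ω : Ω, Nat.card (orbit G (ω.out : X)) ≡
      ∑ ω : Ω, (if Nat.card (stabilizer G (ω.out : X)) = n then m else 0) [MOD m * s] :=
    Nat.ModEq.sum fun ω _ => horb ω.out
  convert h2 using 1
  rw [← Finset.sum_filter, Finset.sum_const, smul_eq_mul, mul_comm, Nat.card_eq_fintype_card,
    Fintype.card_subtype]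

/-- Any subgroup of order `n` lies in the kernel of the `n`-th power map, which has only `n`
elements. -/
theorem IsCyclic.numOfCard_eq_one {C : Type*} [CommGroup C] [IsCyclic C] [Finite C] {n : ℕ}
    (hn : n ∣ Nat.card C) : Subgroup.numOfCard C n = 1 := by
  have hker : Nat.card (powMonoidHom (α := C) n).ker = n := by
    rw [IsCyclic.card_powMonoidHom_ker, Nat.gcd_eq_right hn]
  rw [Subgroup.numOfCard, Nat.card_eq_one_iff_unique]
  refine ⟨⟨?_⟩, ⟨_, hker⟩⟩
  have key : ∀ H : Subgroup C, Nat.card H = n → H = (powMonoidHom (α := C) n).ker := by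
    intro H hH
    apply Subgroup.eq_of_le_of_card_ge
    · intro x hx
      rw [MonoidHom.mem_ker, powMonoidHom_apply, ← hH]
      exact congrArg Subtype.val (pow_card_eq_one' (x := (⟨x, hx⟩ : H)))
    · rw [hker, hH]
  rintro ⟨H, hH⟩ ⟨K, hK⟩
  exact Subtype.ext ((key H hH).trans (key K hK).symm)

/-- Frobenius: the number of subgroups of order a given power of a prime `s` is `1` modulo `s`. -/
theorem Subgroup.numOfCard_prime_pow_modEq_one [Finite G] {s k : ℕ} (hs : s.Prime)
    (hG : s ^ k ∣ Nat.card G) : numOfCard G (s ^ k) ≡ 1 [MOD s] := by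
  obtain ⟨m, hm⟩ := hG
  rw [mul_comm] at hm
  have hpos : 0 < Nat.card G := Nat.card_pos
  have : NeZero (Nat.card G) := ⟨hpos.ne'⟩
  -- The binomial coefficient depends only on `|G|`, so comparison with the cyclic group of that
  -- order, where the count is 1, avoids evaluating it.
  have hC : Nat.card (Multiplicative (ZMod (Nat.card G))) = Nat.card G := by
    rw [Nat.card_congr Multiplicative.toAdd, Nat.card_zmod]
  have h1 := choose_modEq_mul_numOfCard hs hm
  have h2 := choose_modEq_mul_numOfCard (G := Multiplicative (ZMod (Nat.card G))) hs (hC.trans hm)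
  rw [hC, IsCyclic.numOfCard_eq_one (by rw [hC]; exact hm ▸ dvd_mul_left _ _)] at h2
  have hm0 : m ≠ 0 := by rintro rfl; omega
  exact Nat.ModEq.mul_left_cancel' hm0 (h1.symm.trans h2)

end Wielandt

/-! ### Subgroups forced by normality or by its failure -/

section Counting

open Subgroup

variable {G : Type u} [Group G]

theorem Subgroup.numOfCard_pos [Finite G] {n : ℕ} (H : Subgroup G) (hH : Nat.card H = n) :
    1 ≤ numOfCard G n :=
  have : Nonempty {H : Subgroup G // Nat.card H = n} := ⟨⟨H, hH⟩⟩
  Nat.card_pos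

theorem Subgroup.normal_of_numOfCard_eq_one {n : ℕ} (h : numOfCard G n = 1) :
    ∃ H : Subgroup G, Nat.card H = n ∧ H.Normal := by
  obtain ⟨hsub, ⟨H, hH⟩⟩ := Nat.card_eq_one_iff_unique.1 h
  refine ⟨H, hH, ⟨fun x hx g => ?_⟩⟩
  have hc : Nat.card (H.map (MulAut.conj g).toMonoidHom) = n :=
    (Nat.card_congr (H.equivMapOfInjective _ (MulAut.conj g).injective).toEquiv).symm.trans hH
  have := congrArg Subtype.val (hsub.elim ⟨_, hc⟩ ⟨H, hH⟩)
  rw [← show H.map (MulAut.conj g).toMonoidHom = H from this]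
  exact ⟨x, hx, rfl⟩

theorem Subgroup.card_sup_of_coprime (H K : Subgroup G) [H.Normal]
    (h : (Nat.card H).Coprime (Nat.card K)) :
    Nat.card (H ⊔ K : Subgroup G) = Nat.card H * Nat.card K := by
  have h1 : Nat.card H * H.relIndex (H ⊔ K) = Nat.card (H ⊔ K : Subgroup G) := by
    rw [← relIndex_bot_left, relIndex_mul_relIndex _ _ _ bot_le le_sup_left, relIndex_bot_left]
  rw [← h1, relIndex_sup_left, ← inf_relIndex_right,
    (disjoint_of_coprime_natCard h).eq_bot, relIndex_bot_left]

variable [Finite G]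

/-- There is one subgroup of order `s ^ k`, which is then normal, or there are at least `s + 1`. -/
theorem Subgroup.numOfCard_prime_pow_eq_one_or {s k : ℕ} (hs : s.Prime)
    (hk : s ^ k ∣ Nat.card G) : numOfCard G (s ^ k) = 1 ∨ s + 1 ≤ numOfCard G (s ^ k) := by
  have : Fact s.Prime := ⟨hs⟩
  obtain ⟨H, hH⟩ := Sylow.exists_subgroup_card_pow_prime s hk
  have hpos := numOfCard_pos H hH
  have hdvd := (Nat.modEq_iff_dvd' hpos).1 (numOfCard_prime_pow_modEq_one hs hk).symm
  rcases hpos.eq_or_lt with h | h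
  · exact Or.inl h.symm
  · have := Nat.le_of_dvd (by omega) hdvd
    omega

/-- Subgroups whose order has `s`-part `s ^ k`: there are more than `s` of order `s ^ k`, or a
normal one, whose products with `t`- and `u`-subgroups are counted. -/
theorem Subgroup.one_add_min_le_sum_numOfCard {s t u k f g : ℕ} (hs : s.Prime) (ht : t.Prime)
    (hu : u.Prime) (hst : s ≠ t) (hsu : s ≠ u) (hk : s ^ k ∣ Nat.card G)
    (hf : t ^ f ∣ Nat.card G) (hg : u ^ g ∣ Nat.card G) :
    1 + min (f + 1) s ≤ numOfCard G (s ^ k) +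
      ((∑ l ∈ Finset.Icc 1 f, numOfCard G (s ^ k * t ^ l)) + numOfCard G (s ^ k * u ^ g)) := by
  rcases numOfCard_prime_pow_eq_one_or hs hk with h | h
  · obtain ⟨H, hH, hn⟩ := normal_of_numOfCard_eq_one h
    have key : ∀ {v l : ℕ}, v.Prime → s ≠ v → v ^ l ∣ Nat.card G →
        1 ≤ numOfCard G (s ^ k * v ^ l) := by
      intro v l hv hsv hl
      have : Fact v.Prime := ⟨hv⟩
      obtain ⟨K, hK⟩ := Sylow.exists_subgroup_card_pow_prime v hl
      refine numOfCard_pos (H ⊔ K) ?_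
      rw [card_sup_of_coprime, hH, hK]
      rw [hH, hK]
      exact Nat.coprime_pow_primes _ _ hs hv hsv
    have h1 := key hu hsu hg
    have h2 : f ≤ ∑ l ∈ Finset.Icc 1 f, numOfCard G (s ^ k * t ^ l) := by
      calc f = ∑ l ∈ Finset.Icc 1 f, 1 := by simp
        _ ≤ _ := Finset.sum_le_sum fun l hl =>
          key ht hst ((pow_dvd_pow t (Finset.mem_Icc.1 hl).2).trans hf)
    have := min_le_left (f + 1) s
    omega
  · have := min_le_right (f + 1) s
    omega

/-- If a normal subgroup has a normal complement of coprime order, the group decomposes. -/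
theorem isCoprimeDirectProduct_of_isComplement' {H K : Subgroup G} [hH : H.Normal] [hK : K.Normal]
    (h : H.IsComplement' K) (hcop : (Nat.card H).Coprime (Nat.card K)) (hH1 : Nat.card H ≠ 1)
    (hK1 : Nat.card K ≠ 1) : IsCoprimeDirectProduct G := by
  have hcomm : ∀ (x : H) (y : K), Commute (H.subtype x) (K.subtype y) := fun x y =>
    commute_of_normal_of_disjoint H K hH hK h.disjoint x y x.2 y.2
  refine ⟨H, K, inferInstance, inferInstance, ?_, ?_, hcop, ⟨(MulEquiv.ofBijective
    (MonoidHom.noncommCoprod H.subtype K.subtype hcomm) ?_).symm⟩⟩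
  · exact Finite.one_lt_card_iff_nontrivial.1 (by have := Nat.card_pos (α := H); omega)
  · exact Finite.one_lt_card_iff_nontrivial.1 (by have := Nat.card_pos (α := K); omega)
  · exact h

theorem Subgroup.index_normalizer_le_numOfCard {n : ℕ} (K : Subgroup G) (hK : Nat.card K = n) :
    (normalizer (K : Set G)).index ≤ numOfCard G n := by
  have hconj : ∀ g : G, Nat.card (K.map (MulAut.conj g).toMonoidHom) = n := fun g =>
    (Nat.card_congr (K.equivMapOfInjective _ (MulAut.conj g).injective).toEquiv).symm.trans hK
  refine Nat.card_le_card_of_injective (fun x : G ⧸ normalizer (K : Set G) =>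
    (⟨_, hconj x.out⟩ : {H : Subgroup G // Nat.card H = n})) fun x y hxy => ?_
  have h : K.map (MulAut.conj x.out).toMonoidHom = K.map (MulAut.conj y.out).toMonoidHom :=
    congrArg Subtype.val hxy
  rw [← QuotientGroup.out_eq' x, ← QuotientGroup.out_eq' y, QuotientGroup.eq,
    mem_normalizer_iff_map_conj_eq]
  have h2 := congrArg (Subgroup.map (MulAut.conj x.out⁻¹).toMonoidHom) h
  rw [map_map, map_map] at h2
  convert h2.symm using 1
  · congr 1
    ext z
    simp [mul_assoc]
  · ext z
    simp [Subgroup.mem_map, mul_assoc]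

/-- In a coprime-indecomposable group, a normal Sylow subgroup has many complements. -/
theorem Subgroup.succ_le_numOfCard_add_numOfCard {s e m : ℕ} (hs : s.Prime) (he : e ≠ 0)
    (hm : m ≠ 1) (hcop : (s ^ e).Coprime m) (hG : Nat.card G = s ^ e * m)
    (hdec : ¬ IsCoprimeDirectProduct G) :
    s + 1 ≤ numOfCard G (s ^ e) + numOfCard G m := by
  rcases numOfCard_prime_pow_eq_one_or hs (hG ▸ dvd_mul_right (s ^ e) m) with h | h
  · obtain ⟨H, hH, hn⟩ := normal_of_numOfCard_eq_one h
    have hidx : H.index = m := by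
      have := H.card_mul_index
      rw [hH, hG] at this
      exact Nat.eq_of_mul_eq_mul_left (pow_pos hs.pos e) this
    obtain ⟨K, hHK⟩ := exists_right_complement'_of_coprime (N := H) (by rwa [hH, hidx])
    have hK : Nat.card K = m := by rw [← hidx, hHK.symm.index_eq_card]
    have hle := index_normalizer_le_numOfCard K hK
    -- The normalizer contains `K`, whose index is `s ^ e`; the number of conjugates is thus a power
    -- of `s`.
    have hdvd : (normalizer (K : Set G)).index ∣ s ^ e := by
      rw [← hH, ← hHK.index_eq_card]
      exact index_dvd_of_le le_normalizer
    obtain ⟨j, -, hj⟩ := (Nat.dvd_prime_pow hs).1 hdvd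
    have hj0 : j ≠ 0 := by
      rintro rfl
      have : K.Normal := normalizer_eq_top_iff.1 (index_eq_one.1 (by simpa using hj))
      refine hdec (isCoprimeDirectProduct_of_isComplement' hHK (by rwa [hH, hK]) ?_ (hK ▸ hm))
      rw [hH]
      exact (Nat.one_lt_pow he hs.one_lt).ne'
    have := Nat.le_self_pow hj0 s
    omega
  · omega

end Counting

/-! ### Disjoint families in the box of exponents -/

section Sums

open Finset

theorem Finset.sum_Icc_zero_eq_ends_add {n : ℕ} (hn : 1 ≤ n) (f : ℕ → ℕ) :
    ∑ x ∈ Icc 0 n, f x = f 0 + (∑ x ∈ Ico 1 n, f x) + f n := by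
  rw [← Finset.sum_Ico_add_eq_sum_Icc (Nat.zero_le n), Finset.sum_eq_sum_Ico_succ_bot hn]

theorem Finset.sum_Icc_one_eq_add_last {n : ℕ} (hn : 1 ≤ n) (f : ℕ → ℕ) :
    ∑ x ∈ Icc 1 n, f x = (∑ x ∈ Ico 1 n, f x) + f n :=
  (Finset.sum_Ico_add_eq_sum_Icc hn).symm

/-- Part of a sum over a box of exponents: three families of cyclically arranged points with an
intermediate exponent, and the corners. -/
theorem sum_blocks_add_sum_corners_le {a b c : ℕ} (ha : 1 ≤ a) (hb : 1 ≤ b) (hc : 1 ≤ c)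
    (F : ℕ → ℕ → ℕ → ℕ) :
    (∑ x ∈ Ico 1 a, (F x 0 0 + ((∑ l ∈ Icc 1 b, F x l 0) + F x 0 c)))
      + (∑ y ∈ Ico 1 b, (F 0 y 0 + ((∑ l ∈ Icc 1 c, F 0 y l) + F a y 0)))
      + (∑ z ∈ Ico 1 c, (F 0 0 z + ((∑ l ∈ Icc 1 a, F l 0 z) + F 0 b z)))
      + ((F a 0 0 + F 0 b c) + (F 0 b 0 + F a 0 c) + (F 0 0 c + F a b 0) + F 0 0 0 + F a b c)
      ≤ ∑ x ∈ Icc 0 a, ∑ y ∈ Icc 0 b, ∑ z ∈ Icc 0 c, F x y z := by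
  -- The cyclic arrangement makes the third family sum over `z` outside `x`, opposite to the box.
  have hcomm : ∑ z ∈ Ico 1 c, ∑ x ∈ Ico 1 a, F x 0 z = ∑ x ∈ Ico 1 a, ∑ z ∈ Ico 1 c, F x 0 z :=
    Finset.sum_comm
  simp only [Finset.sum_Icc_zero_eq_ends_add ha, Finset.sum_Icc_zero_eq_ends_add hb,
    Finset.sum_Icc_zero_eq_ends_add hc, Finset.sum_Icc_one_eq_add_last ha,
    Finset.sum_Icc_one_eq_add_last hb, Finset.sum_Icc_one_eq_add_last hc,
    Finset.sum_add_distrib, hcomm]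
  omega

theorem Finset.pred_mul_le_sum_Ico {n d : ℕ} {f : ℕ → ℕ} (h : ∀ x ∈ Ico 1 n, d ≤ f x) :
    (n - 1) * d ≤ ∑ x ∈ Ico 1 n, f x := by
  simpa using Finset.card_nsmul_le_sum (Ico 1 n) f d h

end Sums

/-! ### Distinct exponents give distinct orders -/

section Exponents

theorem Nat.primePow_mul_injective {p q r : ℕ} (hp : p.Prime) (hq : q.Prime) (hr : r.Prime)
    (hpq : p ≠ q) (hpr : p ≠ r) (hqr : q ≠ r) :
    Function.Injective fun x : ℕ × ℕ × ℕ => p ^ x.1 * q ^ x.2.1 * r ^ x.2.2 := by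
  have key : ∀ x : ℕ × ℕ × ℕ, (p ^ x.1 * q ^ x.2.1 * r ^ x.2.2).factorization =
      Finsupp.single p x.1 + Finsupp.single q x.2.1 + Finsupp.single r x.2.2 := by
    intro x
    have h1 := (pow_pos hp.pos x.1).ne'
    have h2 := (pow_pos hq.pos x.2.1).ne'
    have h3 := (pow_pos hr.pos x.2.2).ne'
    rw [Nat.factorization_mul (mul_ne_zero h1 h2) h3, Nat.factorization_mul h1 h2,
      hp.factorization_pow, hq.factorization_pow, hr.factorization_pow]
  intro x y hxy
  have h := (key x).symm.trans ((congrArg Nat.factorization hxy).trans (key y))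
  refine Prod.ext ?_ (Prod.ext ?_ ?_)
  · simpa [Finsupp.single_apply, hpq.symm, hpr.symm] using DFunLike.congr_fun h p
  · simpa [Finsupp.single_apply, hpq, hqr.symm] using DFunLike.congr_fun h q
  · simpa [Finsupp.single_apply, hpr, hqr] using DFunLike.congr_fun h r

theorem Subgroup.sum_numOfCard_le_card {G : Type*} [Group G] [Finite G] (S : Finset ℕ) :
    ∑ n ∈ S, numOfCard G n ≤ Nat.card (Subgroup G) := by
  classical
  have : Fintype (Subgroup G) := Fintype.ofFinite _
  rw [Nat.card_eq_fintype_card, ← Finset.card_univ]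
  refine le_trans (le_of_eq ?_) (Finset.card_le_univ
    (S.biUnion fun n => Finset.univ.filter fun H : Subgroup G => Nat.card H = n))
  rw [Finset.card_biUnion]
  · refine Finset.sum_congr rfl fun n _ => ?_
    rw [numOfCard, Nat.card_eq_fintype_card, Fintype.card_subtype]
  · intro m _ n _ hmn
    refine Finset.disjoint_left.2 fun H hm hn => hmn ?_
    rw [← (Finset.mem_filter.1 hm).2, (Finset.mem_filter.1 hn).2]

theorem Subgroup.sum_numOfCard_primePow_mul_le_card {G : Type*} [Group G] [Finite G]
    {p q r : ℕ} (hp : p.Prime) (hq : q.Prime) (hr : r.Prime)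
    (hpq : p ≠ q) (hpr : p ≠ r) (hqr : q ≠ r) (a b c : ℕ) :
    ∑ x ∈ Finset.Icc 0 a, ∑ y ∈ Finset.Icc 0 b, ∑ z ∈ Finset.Icc 0 c,
      numOfCard G (p ^ x * q ^ y * r ^ z) ≤ Nat.card (Subgroup G) := by
  classical
  refine le_trans (le_of_eq ?_) (sum_numOfCard_le_card (G := G)
    ((Finset.Icc 0 a ×ˢ Finset.Icc 0 b ×ˢ Finset.Icc 0 c).image
      fun x : ℕ × ℕ × ℕ => p ^ x.1 * q ^ x.2.1 * r ^ x.2.2))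
  rw [Finset.sum_image fun x _ y _ h => Nat.primePow_mul_injective hp hq hr hpq hpr hqr h]
  simp only [Finset.sum_product]

end Exponents

/-- The bound holds with `p + q + r + 2` in place of the last minimum. Nilpotency needs no separate
treatment: a nilpotent group of this order is a coprime direct product. -/
theorem mainTheorem4 {G : Type u} [Group G] (p q r a b c i j : ℕ)
    (hp : p.Prime) (hq : q.Prime) (hr : r.Prime) (hpq : p < q) (hqr : q < r)
    (ha : 1 ≤ a) (hb : 1 ≤ b) (hc : 1 ≤ c)
    (hcard : Nat.card G = p ^ a * q ^ b * r ^ c)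
    (hnil : ¬ Group.IsNilpotent G)
    (hdec : ¬ IsCoprimeDirectProduct G)
    (hi : IsLeast {k : ℕ | r + 1 ≤ p ^ k} i)
    (hj : IsLeast {k : ℕ | r + 1 ≤ q ^ k} j) :
    a + b + c + (a - 1) * min (b + 1) p + (b - 1) * min (c + 1) q + (c - 1) * min (a + 1) r
        + min (p + q + r + 2)
            (min (q + 2 + min (p ^ i + 1) (min (q ^ j) (2 * r + 1)))
              (min (r + 1) (2 * q + 2) + min (r + 1) (2 * q)))
      ≤ Nat.card (Subgroup G) := by
  have hp0 := pow_pos hp.pos a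
  have hq0 := pow_pos hq.pos b
  have hr0 := pow_pos hr.pos c
  have : Finite G := Nat.finite_of_card_ne_zero (by rw [hcard]; positivity)
  have hpr := hpq.trans hqr
  have hcpq := Nat.coprime_pow_primes a b hp hq hpq.ne
  have hcpr := Nat.coprime_pow_primes a c hp hr hpr.ne
  have hcqr := Nat.coprime_pow_primes b c hq hr hqr.ne
  have hpdvd : p ^ a ∣ Nat.card G := ⟨q ^ b * r ^ c, by rw [hcard]; ring⟩
  have hqdvd : q ^ b ∣ Nat.card G := ⟨p ^ a * r ^ c, by rw [hcard]; ring⟩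
  have hrdvd : r ^ c ∣ Nat.card G := ⟨p ^ a * q ^ b, by rw [hcard]; ring⟩
  have hp1 : p ^ a ≠ 1 := (Nat.one_lt_pow (by omega) hp.one_lt).ne'
  have hq1 : q ^ b ≠ 1 := (Nat.one_lt_pow (by omega) hq.one_lt).ne'
  have hsum := (sum_blocks_add_sum_corners_le ha hb hc
    fun x y z => Subgroup.numOfCard G (p ^ x * q ^ y * r ^ z)).trans
    (Subgroup.sum_numOfCard_primePow_mul_le_card hp hq hr hpq.ne hpr.ne hqr.ne a b c)
  simp only [pow_zero, one_mul, mul_one] at hsum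
  have h1 := Finset.pred_mul_le_sum_Ico (n := a) (d := 1 + min (b + 1) p) fun x hx =>
    Subgroup.one_add_min_le_sum_numOfCard hp hq hr hpq.ne hpr.ne
      ((pow_dvd_pow p (Finset.mem_Ico.1 hx).2.le).trans hpdvd) hqdvd hrdvd
  have h2 := Finset.pred_mul_le_sum_Ico (n := b) (d := 1 + min (c + 1) q) fun x hx =>
    Subgroup.one_add_min_le_sum_numOfCard hq hr hp hqr.ne hpq.ne'
      ((pow_dvd_pow q (Finset.mem_Ico.1 hx).2.le).trans hqdvd) hrdvd hpdvd
  have h3 := Finset.pred_mul_le_sum_Ico (n := c) (d := 1 + min (a + 1) r) fun x hx =>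
    Subgroup.one_add_min_le_sum_numOfCard hr hp hq hpr.ne' hqr.ne'
      ((pow_dvd_pow r (Finset.mem_Ico.1 hx).2.le).trans hrdvd) hpdvd hqdvd
  -- The cyclic roles of the primes permute the factors; this restores the order `p`, `q`, `r` used
  -- in `hsum`.
  simp only [mul_comm (r ^ _) (p ^ _), mul_comm (r ^ _) (q ^ _), mul_comm (q ^ _) (p ^ _)]
    at h1 h2 h3
  have h4 := Subgroup.succ_le_numOfCard_add_numOfCard (m := q ^ b * r ^ c) hp (by omega)
    (fun h => hq1 (Nat.eq_one_of_mul_eq_one_right h)) (hcpq.mul_right hcpr)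
    (by rw [hcard]; ring) hdec
  have h5 := Subgroup.succ_le_numOfCard_add_numOfCard (m := p ^ a * r ^ c) hq (by omega)
    (fun h => hp1 (Nat.eq_one_of_mul_eq_one_right h)) (hcpq.symm.mul_right hcqr)
    (by rw [hcard]; ring) hdec
  have h6 := Subgroup.succ_le_numOfCard_add_numOfCard (m := p ^ a * q ^ b) hr (by omega)
    (fun h => hp1 (Nat.eq_one_of_mul_eq_one_right h)) (hcpr.symm.mul_right hcqr.symm)
    (by rw [hcard]; ring) hdec
  have h7 := Subgroup.numOfCard_pos (⊥ : Subgroup G) Subgroup.card_bot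
  have h8 := Subgroup.numOfCard_pos (⊤ : Subgroup G) (Subgroup.card_top.trans hcard)
  rw [mul_add, mul_one] at h1 h2 h3
  have hM := min_le_left (p + q + r + 2)
    (min (q + 2 + min (p ^ i + 1) (min (q ^ j) (2 * r + 1)))
      (min (r + 1) (2 * q + 2) + min (r + 1) (2 * q)))
  -- The leading 1 in each intermediate bound gives `a + b + c - 3`; the corners give `(p + 1) + (q
  -- + 1) + (r + 1) + 2`.
  omega
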